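/- Let $\mathcal X,\mathcal Y$ be finite-dimensional real Hilbert spaces with Lebesgue measure, $\Theta$ a parameter set, $\theta\in\Theta$ fixed, $Q\ge 1$ and $\nu>0$ (in particular $\nu\in\,]0,2/L[$ is allowed). Let $F:\mathcal X\times\mathcal Y\times\Theta\to\mathbb R$ be such that, for every $y$, $F(\cdot,y,\theta)$ is convex and $C^1$ with $L$-Lipschitz gradient $\nabla_1F(\cdot,y,\theta)$. For $k=1,\dots,Q$ let $G_k(\cdot,y,\theta):\mathcal X\to\,]-\infty,+\infty]$ be proper, closed and convex for every $y$, and write $\mathrm{Prox}_{\nu QG_k}(x,y,\theta)=\operatorname{argmin}_{z}\ \tfrac12\|z-x\|^2+\nu Q\,G_k(z,y,\theta)$. Put $a=(\xi,z_1,\dots,z_Q)\in\mathcal A=\mathcal X^{1+Q}$, $\gamma(a)=\xi$, and consider the Generalized Forward--Backward iterates $x^{(\ell)}=\gamma(a^{(\ell)})$, $a^{(\ell+1)}=\psi(a^{(\ell)},y,\theta)$ given by $$x^{(\ell+1)}=\tfrac1Q\sum_{k=1}^Q z_k^{(\ell+1)},\quad z_k^{(\ell+1)}=z_k^{(\ell)}-x^{(\ell)}+\mathrm{Prox}_{\nu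 QG_k}(Z_k^{(\ell)},y,\theta),\quad Z_k^{(\ell)}=2x^{(\ell)}-z_k^{(\ell)}-\nu\nabla_1F(x^{(\ell)},y,\theta),$$ started at some $a^{(0)}(y,\theta)$. Assume that $y\mapsto a^{(0)}(y,\theta)$ is Lipschitz and that $y\mapsto\nabla_1F(x,y,\theta)$ and $y\mapsto\mathrm{Prox}_{\nu QG_k}(x,y,\theta)$ are Lipschitz with constants independent of $x$. Then, for all $\ell$ and $k$, the maps $a^{(\ell)}$, $x^{(\ell)}$, $z_k^{(\ell)}$, $Z_k^{(\ell)}$ are weakly differentiable in $y$. Moreover one can choose versions of the partial weak Jacobians (in the first and in the second argument, for every fixed value of the other one) of $\psi(\cdot,\cdot,\theta)$, $\mathrm{Prox}_{\nu QG_k}(\cdot,\cdot,\theta)$ and $\nabla_1F(\cdot,\cdot,\theta)$, and of the weak Jacobian of $\gamma$, each of which equals the classical (partial) Jacobian at every point where the latter exists, such that the following holds. Let $D_a^{(\ell)},D_x^{(\ell)},D_{z_k}^{(\ell)},D_{Z_k}^{(\ell)}$ denote the weak Jacobians in $y$ of $a^{(\ell)},x^{(\ell)},z_k^{(\ell)},Z_k^{(\ell)}$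 (any versions) applied to a direction $\delta$. For almost every $y\in\mathcal Y$, all $\delta\in\mathcal Y$, all $\ell\ge0$ and all $k$, one has $D_a^{(\ell)}=(D_x^{(\ell)},D_{z_1}^{(\ell)},\dots,D_{z_Q}^{(\ell)})$, $D_x^{(\ell)}=\Gamma_a^{(\ell)}(D_a^{(\ell)})$, $D_a^{(\ell+1)}=\Psi_a^{(\ell)}(D_a^{(\ell)})+\Psi_y^{(\ell)}(\delta)$, and $$D_x^{(\ell+1)}=\tfrac1Q\sum_{k=1}^QD_{z_k}^{(\ell+1)},\qquad D_{z_k}^{(\ell+1)}=D_{z_k}^{(\ell)}-D_x^{(\ell)}+\mathcal G_{k,x}^{(\ell)}(D_{Z_k}^{(\ell)})+\mathcal G_{k,y}^{(\ell)}(\delta),$$ $$D_{Z_k}^{(\ell)}=2D_x^{(\ell)}-D_{z_k}^{(\ell)}-\nu\big(\mathcal F_x^{(\ell)}(D_x^{(\ell)})+\mathcal F_y^{(\ell)}(\delta)\big),$$ where $\Gamma_a^{(\ell)}$ is the Jacobian of $\gamma$ at $a^{(\ell)}$; $\Psi_a^{(\ell)},\Psi_y^{(\ell)}$ are the chosen Jacobians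 of $\psi$ in its first and second argument at $(a^{(\ell)},y,\theta)$; $\mathcal G_{k,x}^{(\ell)},\mathcal G_{k,y}^{(\ell)}$ those of $\mathrm{Prox}_{\nu QG_k}$ at $(Z_k^{(\ell)},y,\theta)$; and $\mathcal F_x^{(\ell)},\mathcal F_y^{(\ell)}$ those of $\nabla_1F$ at $(x^{(\ell)},y,\theta)$. Furthermore, for these $y,\delta,\ell,k$, the vector $\Psi_a^{(\ell)}(D_a^{(\ell)})+\Psi_y^{(\ell)}(\delta)$ is the directional derivative of $\psi(\cdot,\cdot,\theta)$ at $(a^{(\ell)},y)$ along $(D_a^{(\ell)},\delta)$, $\mathcal G_{k,x}^{(\ell)}(D_{Z_k}^{(\ell)})+\mathcal G_{k,y}^{(\ell)}(\delta)$ is that of $\mathrm{Prox}_{\nu QG_k}(\cdot,\cdot,\theta)$ at $(Z_k^{(\ell)},y)$ along $(D_{Z_k}^{(\ell)},\delta)$, and $\mathcal F_x^{(\ell)}(D_x^{(\ell)})+\mathcal F_y^{(\ell)}(\delta)$ is that of $\nabla_1F(\cdot,\cdot,\theta)$ at $(x^{(\ell)},y)$ along $(D_x^{(\ell)},\delta)$.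 -/

import Mathlib

open MeasureTheory
open scoped NNReal

noncomputable section

/-! ### Weak Jacobians -/

section Weak

variable {E W : Type*} [NormedAddCommGroup E] [NormedSpace ℝ E] [MeasureSpace E]
  [NormedAddCommGroup W] [NormedSpace ℝ W]

/-- `J` is (a version of) the weak Jacobian of `h` on the whole space `E`: both are locally
integrable and the integration by parts formula against every `C¹` test function with compact
support holds, for the partial derivative in every direction `v`. A weak Jacobian is only
determined up to a Lebesgue-null set. -/
structure IsWeakJacobian (h : E → W) (J : E → E →L[ℝ] W) : Prop where
  locallyIntegrable_fun : LocallyIntegrable h volume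
  locallyIntegrable_jac : LocallyIntegrable J volume
  integral_eq : ∀ (v : E) (φ : E → ℝ), ContDiff ℝ 1 φ → HasCompactSupport φ →
    ∫ a, φ a • J a v = - ∫ a, fderiv ℝ φ a v • h a

/-- `h` is weakly differentiable. -/
def WeaklyDifferentiable (h : E → W) : Prop :=
  ∃ J : E → E →L[ℝ] W, IsWeakJacobian h J

/-- `J` is a version of the weak Jacobian of `h` which, at every point at which `h` is
differentiable in the classical (Fréchet) sense, is equal to the classical Jacobian of `h`. -/
structure IsPointwiseWeakJacobian (h : E → W) (J : E → E →L[ℝ] W) : Prop where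
  isWeakJacobian : IsWeakJacobian h J
  eq_fderiv : ∀ a, DifferentiableAt ℝ h a → J a = fderiv ℝ h a

end Weak

/-! ### Convex functions and proximal maps -/

section Prox

variable {X : Type*} [NormedAddCommGroup X] [InnerProductSpace ℝ X]

/-- An extended-real-valued function is proper, closed (lower semicontinuous) and convex
(its epigraph is convex). -/
structure IsProperClosedConvex (G : X → EReal) : Prop where
  ne_bot : ∀ x, G x ≠ ⊥
  exists_ne_top : ∃ x, G x ≠ ⊤
  closed : LowerSemicontinuous G
  convex : Convex ℝ {p : X × ℝ | G p.1 ≤ (p.2 : EReal)}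

/-- The proximal map of `G` at `x`: the minimizer `z` of `‖z - x‖² / 2 + G z`
(which exists and is unique if `G` is proper, closed and convex). -/
def prox (G : X → EReal) (x : X) : X :=
  Classical.epsilon fun p : X =>
    ∀ z : X, ((1 / 2 * ‖p - x‖ ^ 2 : ℝ) : EReal) + G p ≤ ((1 / 2 * ‖z - x‖ ^ 2 : ℝ) : EReal) + G z

end Prox

/-! ### Generalized Forward-Backward splitting -/

section GFB

variable {X Y Θ : Type*} [NormedAddCommGroup X] [InnerProductSpace ℝ X] [CompleteSpace X] {Q : ℕ}

/-- The gradient of `F` with respect to its first argument. -/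
def gradFst (F : X → Y → Θ → ℝ) (x : X) (y : Y) (θ : Θ) : X :=
  gradient (fun x' => F x' y θ) x

/-- `Prox_{ν Q G_k}(x, y, θ)`, the proximal map being taken in the first argument. -/
def gfbProx (ν : ℝ) (G : Fin Q → X → Y → Θ → EReal) (k : Fin Q) (x : X) (y : Y) (θ : Θ) : X :=
  prox (fun x' => ((ν * (Q : ℝ) : ℝ) : EReal) * G k x' y θ) x

/-- The output map `γ` on the auxiliary variable `a = (ξ, z_1, …, z_Q)`. -/
def gfbGamma (a : X × (Fin Q → X)) : X := a.1

/-- `Z_k = 2 x - z_k - ν ∇₁F(x, y, θ)`, with `a = (x, z_1, …, z_Q)`. -/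
def gfbZ (ν : ℝ) (F : X → Y → Θ → ℝ) (k : Fin Q) (a : X × (Fin Q → X)) (y : Y) (θ : Θ) : X :=
  (2 : ℝ) • gfbGamma a - a.2 k - ν • gradFst F (gfbGamma a) y θ

/-- The new value `z_k - x + Prox_{ν Q G_k}(Z_k, y, θ)` of the variable `z_k`. -/
def gfbNewz (ν : ℝ) (F : X → Y → Θ → ℝ) (G : Fin Q → X → Y → Θ → EReal)
    (a : X × (Fin Q → X)) (y : Y) (θ : Θ) (k : Fin Q) : X :=
  a.2 k - gfbGamma a + gfbProx ν G k (gfbZ ν F k a y θ) y θ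

/-- The iteration map `ψ(a, y, θ)`. -/
def gfbPsi (ν : ℝ) (F : X → Y → Θ → ℝ) (G : Fin Q → X → Y → Θ → EReal)
    (a : X × (Fin Q → X)) (y : Y) (θ : Θ) : X × (Fin Q → X) :=
  ((1 / (Q : ℝ)) • ∑ k, gfbNewz ν F G a y θ k, gfbNewz ν F G a y θ)

/-- The auxiliary iterates `a^(ℓ)(y, θ)` started at `a₀(y, θ)`. -/
def gfbA (ν : ℝ) (F : X → Y → Θ → ℝ) (G : Fin Q → X → Y → Θ → EReal)
    (a₀ : Y → Θ → X × (Fin Q → X)) : ℕ → Y → Θ → X × (Fin Q → X)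
  | 0, y, θ => a₀ y θ
  | ℓ + 1, y, θ => gfbPsi ν F G (gfbA ν F G a₀ ℓ y θ) y θ

/-- The iterates `x^(ℓ)(y, θ) = γ(a^(ℓ)(y, θ))`. -/
def gfbX (ν : ℝ) (F : X → Y → Θ → ℝ) (G : Fin Q → X → Y → Θ → EReal)
    (a₀ : Y → Θ → X × (Fin Q → X)) (ℓ : ℕ) (y : Y) (θ : Θ) : X :=
  gfbGamma (gfbA ν F G a₀ ℓ y θ)

/-- The iterates `z_k^(ℓ)(y, θ)`. -/
def gfbz (ν : ℝ) (F : X → Y → Θ → ℝ) (G : Fin Q → X → Y → Θ → EReal)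
    (a₀ : Y → Θ → X × (Fin Q → X)) (ℓ : ℕ) (k : Fin Q) (y : Y) (θ : Θ) : X :=
  (gfbA ν F G a₀ ℓ y θ).2 k

/-- The iterates `Z_k^(ℓ)(y, θ)`. -/
def gfbZIter (ν : ℝ) (F : X → Y → Θ → ℝ) (G : Fin Q → X → Y → Θ → EReal)
    (a₀ : Y → Θ → X × (Fin Q → X)) (ℓ : ℕ) (k : Fin Q) (y : Y) (θ : Θ) : X :=
  gfbZ ν F k (gfbA ν F G a₀ ℓ y θ) y θ

end GFB

end

/-! Proximal maps are nonexpansive and the gradient is Lipschitz, with Lipschitz bounds in `y`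
uniform in the other variable. Hence `ψ`, the proximal maps and `∇₁F` are jointly Lipschitz, and so
is every iterate in `y`. No contraction is used, so `ν > 0` is arbitrary. By Rademacher, every weak
Jacobian of an iterate is a.e. its classical one.

The difficulty is the chain rule for `y ↦ f (c y) y`: the graph of `c` may lie in a null set where
`f` is not differentiable. There the partial Jacobians must be chosen. With `B = c'(y)` and `N` the
derivative of the composite, one needs `N = Ja ∘ B + Jy`, where a classical partial Jacobian is
prescribed whenever it exists. If both exist, the identity holds at a.e. such `y`, by a
density-point argument (`ae_fderiv_comp_graph_eq`). If only one exists, one solves for the other;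
solving for `Ja` requires `N - Jy` to vanish on `ker B`, which follows from the Lipschitz property.
Curves meeting at a point give the same `B` and `N` for a.e. `y` (`ae_fderiv_eq_of_eq`), so one
choice serves countably many curves (`LipschitzWith.exists_partial_jacobians`). The recursions then
follow from uniqueness of the Fréchet derivative. -/

/-! ### Weak Jacobians of Lipschitz maps -/

section WeakJacobian

open Filter Topology

variable {E W : Type*} [NormedAddCommGroup E] [NormedSpace ℝ E] [FiniteDimensional ℝ E]
  [MeasureSpace E] [BorelSpace E] [(volume : Measure E).IsAddHaarMeasure]
  [NormedAddCommGroup W] [NormedSpace ℝ W] [FiniteDimensional ℝ W]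

theorem LipschitzWith.locallyIntegrable_fderiv {h : E → W} {C : ℝ≥0}
    (hh : LipschitzWith C h) : LocallyIntegrable (fderiv ℝ h) volume := by
  have : CompleteSpace W := FiniteDimensional.complete ℝ W
  borelize (E →L[ℝ] W)
  refine MemLp.locallyIntegrable (p := ⊤) ?_ le_top
  exact memLp_top_of_bound (measurable_fderiv ℝ h).aestronglyMeasurable C
    (.of_forall fun x => norm_fderiv_le_of_lipschitz ℝ hh)

/-- Integration by parts for a Lipschitz function and a `C¹` test function. -/
theorem LipschitzWith.integral_smul_fderiv_eq {h : E → W} {C : ℝ≥0} (hh : LipschitzWith C h)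
    (v : E) (φ : E → ℝ) (hφ : ContDiff ℝ 1 φ) (hφ' : HasCompactSupport φ) :
    ∫ a, φ a • fderiv ℝ h a v = - ∫ a, fderiv ℝ φ a v • h a := by
  have : CompleteSpace W := FiniteDimensional.complete ℝ W
  obtain ⟨D, hD⟩ := hφ.lipschitzWith_of_hasCompactSupport hφ' one_ne_zero
  have hφi : Continuous fun a => fderiv ℝ φ a v :=
    (hφ.continuous_fderiv one_ne_zero).clm_apply continuous_const
  have hφs : HasCompactSupport fun a => fderiv ℝ φ a v := by
    refine (hφ'.fderiv (𝕜 := ℝ)).comp_left (g := fun T : E →L[ℝ] ℝ => T v) ?_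
    simp
  have i1 : Integrable (fun a => φ a • fderiv ℝ h a v) := by
    have h1 : LocallyIntegrable (fun a => fderiv ℝ h a v) volume := fun x =>
      (ContinuousLinearMap.apply ℝ W v).integrableAtFilter_comp (hh.locallyIntegrable_fderiv x)
    exact h1.integrable_smul_left_of_hasCompactSupport hφ.continuous hφ'
  have i2 : Integrable (fun a => fderiv ℝ φ a v • h a) :=
    (hh.continuous.locallyIntegrable).integrable_smul_left_of_hasCompactSupport hφi hφs
  -- Test against functionals `T`, which reduces to integration by parts for real-valued Lipschitz
  -- functions.
  refine (SeparatingDual.eq_iff_forall_dual_eq (R := ℝ)).2 fun T => ?_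
  rw [map_neg, ← T.integral_comp_comm i1, ← T.integral_comp_comm i2, ← integral_neg]
  have key := (T.lipschitz.comp hh).integral_lineDeriv_mul_eq (μ := volume) hD hφ' v
  calc ∫ a, T (φ a • fderiv ℝ h a v) = ∫ a, lineDeriv ℝ (T ∘ h) a v * φ a := by
        refine integral_congr_ae ?_
        filter_upwards [hh.ae_differentiableAt (μ := volume)] with a ha
        have : HasFDerivAt (T ∘ h) (T.comp (fderiv ℝ h a)) a := T.hasFDerivAt.comp a ha.hasFDerivAt
        rw [(this.hasLineDerivAt v).lineDeriv]
        simp [mul_comm]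
    _ = ∫ a, lineDeriv ℝ φ a (-v) * (T ∘ h) a := key
    _ = ∫ a, -T (fderiv ℝ φ a v • h a) := by
        refine integral_congr_ae (.of_forall fun a => ?_)
        have := (hφ.differentiable one_ne_zero a).hasFDerivAt
        simp [(this.hasLineDerivAt (-v)).lineDeriv]

/-- By Rademacher the points where `J` is unconstrained form a null set. This leaves the freedom,
used below, to prescribe Jacobians at points of nondifferentiability. -/
theorem LipschitzWith.isPointwiseWeakJacobian {h : E → W} {C : ℝ≥0} (hh : LipschitzWith C h)
    {J : E → E →L[ℝ] W} (hJ : ∀ a, DifferentiableAt ℝ h a → J a = fderiv ℝ h a) :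
    IsPointwiseWeakJacobian h J := by
  have hae : fderiv ℝ h =ᵐ[volume] J := by
    filter_upwards [hh.ae_differentiableAt (μ := volume)] with a ha using (hJ a ha).symm
  refine ⟨⟨hh.continuous.locallyIntegrable, hh.locallyIntegrable_fderiv.congr hae, ?_⟩, hJ⟩
  intro v φ hφ hφ'
  rw [← hh.integral_smul_fderiv_eq v φ hφ hφ']
  refine integral_congr_ae ?_
  filter_upwards [hae] with a ha
  rw [ha]

theorem LipschitzWith.weaklyDifferentiable {h : E → W} {C : ℝ≥0} (hh : LipschitzWith C h) :
    WeaklyDifferentiable h :=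
  ⟨fderiv ℝ h, (hh.isPointwiseWeakJacobian fun _ _ => rfl).isWeakJacobian⟩

-- Fundamental lemma of the calculus of variations, one direction at a time; the exceptional set
-- depends on the direction, so only the finitely many basis vectors are used.
omit [(volume : Measure E).IsAddHaarMeasure] in
theorem IsWeakJacobian.ae_eq {h : E → W} {J J' : E → E →L[ℝ] W} (hJ : IsWeakJacobian h J)
    (hJ' : IsWeakJacobian h J') : J =ᵐ[volume] J' := by
  have : CompleteSpace W := FiniteDimensional.complete ℝ W
  have key : ∀ v, ∀ᵐ a, J a v = J' a v := by
    intro v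
    have loc : ∀ {K : E → E →L[ℝ] W}, LocallyIntegrable K volume →
        LocallyIntegrable (fun a => K a v) volume := fun hK x =>
      (ContinuousLinearMap.apply ℝ W v).integrableAtFilter_comp (hK x)
    refine ae_eq_of_integral_contDiff_smul_eq (loc hJ.locallyIntegrable_jac)
      (loc hJ'.locallyIntegrable_jac) fun φ hφ hφ' => ?_
    rw [hJ.integral_eq v φ (hφ.of_le (by simp)) hφ', hJ'.integral_eq v φ (hφ.of_le (by simp)) hφ']
  let b := Module.finBasis ℝ E
  filter_upwards [ae_all_iff.2 fun i => key (b i)] with a ha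
  exact ContinuousLinearMap.coe_injective (b.ext ha)

/-- Every weak Jacobian of a Lipschitz function is almost everywhere its classical Jacobian. -/
theorem IsWeakJacobian.ae_hasFDerivAt {h : E → W} {J : E → E →L[ℝ] W} (hJ : IsWeakJacobian h J)
    {C : ℝ≥0} (hh : LipschitzWith C h) : ∀ᵐ a, HasFDerivAt h (J a) a := by
  filter_upwards [hJ.ae_eq (hh.isPointwiseWeakJacobian fun _ _ => rfl).isWeakJacobian,
    hh.ae_differentiableAt (μ := volume)] with a ha ha'
  exact ha ▸ ha'.hasFDerivAt

end WeakJacobian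

/-! ### Chain rule along graphs, almost everywhere -/

section ChainRule

open Filter Topology Metric
open scoped Pointwise

variable {A Y W : Type*} [NormedAddCommGroup A] [NormedSpace ℝ A]
  [NormedAddCommGroup Y] [NormedSpace ℝ Y] [NormedAddCommGroup W] [NormedSpace ℝ W]

/-- Almost every point of a set can be approached within the set along every direction. -/
theorem MeasureTheory.ae_mem_forall_exists_seq_tangent [FiniteDimensional ℝ Y] [MeasurableSpace Y]
    [BorelSpace Y] (μ : Measure Y) [μ.IsAddHaarMeasure] {s : Set Y} (hs : MeasurableSet s) :
    ∀ᵐ y ∂μ, y ∈ s → ∀ δ : Y, ∃ (r : ℕ → ℝ) (d : ℕ → Y), Tendsto d atTop (𝓝 0) ∧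
      (∀ n, y + d n ∈ s) ∧ Tendsto (fun n => r n • d n) atTop (𝓝 δ) := by
  rw [← ae_restrict_iff' hs]
  filter_upwards [Besicovitch.ae_tendsto_measure_inter_div μ s] with y hy δ
  -- At a density point `y`, the set `s` meets `y + t • closedBall δ ε` for all small `t > 0`; take
  -- `ε = 1 / (n + 1)` and `t < 1 / (n + 1)`.
  have ex : ∀ n : ℕ, ∃ p : ℝ × Y, 0 < p.1 ∧ p.1 < 1 / ((n : ℝ) + 1) ∧
      ‖p.2 - δ‖ ≤ 1 / ((n : ℝ) + 1) ∧ y + p.1 • p.2 ∈ s := by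
    intro n
    have hn : (0 : ℝ) < 1 / ((n : ℝ) + 1) := by positivity
    have h1 := Measure.eventually_nonempty_inter_smul_of_density_one μ s y hy _
      (measurableSet_closedBall (x := δ) (ε := 1 / ((n : ℝ) + 1)))
      (measure_closedBall_pos μ δ hn).ne'
    obtain ⟨t, ⟨z, hzs, hz⟩, ht⟩ := (h1.and (Ioo_mem_nhdsGT hn)).exists
    obtain ⟨a, ha, b, hb, rfl⟩ := Set.mem_add.1 hz
    obtain ⟨e, he, rfl⟩ := Set.mem_smul_set.1 hb
    obtain rfl := Set.mem_singleton_iff.1 ha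
    exact ⟨(t, e), ht.1, ht.2, by simpa [dist_eq_norm] using he, hzs⟩
  choose p hp0 hp1 hp2 hp3 using ex
  have hlim := tendsto_one_div_add_atTop_nhds_zero_nat (𝕜 := ℝ)
  have ht : Tendsto (fun n => (p n).1) atTop (𝓝 0) :=
    squeeze_zero (fun n => (hp0 n).le) (fun n => (hp1 n).le) hlim
  have hd : Tendsto (fun n => (p n).2) atTop (𝓝 δ) := by
    rw [tendsto_iff_norm_sub_tendsto_zero]
    exact squeeze_zero (fun n => norm_nonneg _) hp2 hlim
  refine ⟨fun n => (p n).1⁻¹, fun n => (p n).1 • (p n).2, by simpa using ht.smul hd, hp3, ?_⟩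
  refine hd.congr fun n => ?_
  simp [smul_smul, (hp0 n).ne']

/-- Two continuous maps have the same derivative at almost every point at which they are both
differentiable and coincide. -/
theorem MeasureTheory.ae_fderiv_eq_of_eq [FiniteDimensional ℝ Y] [MeasurableSpace Y]
    [BorelSpace Y] (μ : Measure Y) [μ.IsAddHaarMeasure] {g h : Y → W}
    (hg : Continuous g) (hh : Continuous h) :
    ∀ᵐ y ∂μ, g y = h y → DifferentiableAt ℝ g y → DifferentiableAt ℝ h y →
      fderiv ℝ g y = fderiv ℝ h y := by
  have hs : IsClosed {y | g y = h y} := isClosed_eq hg hh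
  filter_upwards [ae_mem_forall_exists_seq_tangent μ hs.measurableSet] with y hy heq dg dh
  ext δ
  obtain ⟨r, d, hd, hmem, hrd⟩ := hy heq δ
  -- Along a sequence inside the coincidence set, the difference quotients of `g` and `h` are equal,
  -- hence so are their limits.
  have h1 := (hasFDerivWithinAt_univ.2 dg.hasFDerivAt).lim hd (.of_forall fun _ => trivial) hrd
  have h2 := (hasFDerivWithinAt_univ.2 dh.hasFDerivAt).lim hd (.of_forall fun _ => trivial) hrd
  refine tendsto_nhds_unique h1 (h2.congr fun n => ?_)
  have : g (y + d n) = h (y + d n) := hmem n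
  rw [this, heq]

/-- If both partial derivatives of a continuous map `f` exist along the graph of `c`, then the
total derivative of `y ↦ f (c y) y` is given by the chain rule, almost everywhere. -/
theorem MeasureTheory.ae_fderiv_comp_graph_eq [FiniteDimensional ℝ A] [FiniteDimensional ℝ W]
    [FiniteDimensional ℝ Y] [MeasurableSpace Y] [BorelSpace Y] (μ : Measure Y)
    [μ.IsAddHaarMeasure] {f : A → Y → W} {c : Y → A}
    (hf : Continuous fun p : A × Y => f p.1 p.2) (hc : Continuous c) :
    ∀ᵐ y ∂μ, DifferentiableAt ℝ c y → DifferentiableAt ℝ (fun y => f (c y) y) y →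
      DifferentiableAt ℝ (fun a => f a y) (c y) → DifferentiableAt ℝ (fun y' => f (c y) y') y →
      ∀ δ, fderiv ℝ (fun y => f (c y) y) y δ
        = fderiv ℝ (fun a => f a y) (c y) (fderiv ℝ c y δ) + fderiv ℝ (fun y' => f (c y) y') y δ := by
  -- `M m S n` makes the linear approximation of `f (·, y)` at `c y` by `S` uniform over a ball of
  -- fixed radius. Taking `S` in a countable dense set keeps the family countable, so a.e. `y` has
  -- tangent sequences in every `M m S n` containing it.
  obtain ⟨D, hDc, hD⟩ := TopologicalSpace.exists_countable_dense (A →L[ℝ] W)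
  let M : ℕ → (A →L[ℝ] W) → ℕ → Set Y := fun m S n =>
    {y | ∀ u : A, ‖u‖ ≤ 1 / ((n : ℝ) + 1) →
      ‖f (c y + u) y - f (c y) y - S u‖ ≤ 1 / ((m : ℝ) + 1) * ‖u‖}
  have hM : ∀ m S n, IsClosed (M m S n) := by
    intro m S n
    simp only [M, Set.ofPred_forall]
    refine isClosed_iInter fun u => isClosed_iInter fun _ => isClosed_le ?_ continuous_const
    have h1 : Continuous fun y => f (c y + u) y :=
      hf.comp ((hc.add continuous_const).prodMk continuous_id)
    have h2 : Continuous fun y => f (c y) y := hf.comp (hc.prodMk continuous_id)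
    fun_prop
  have hall : ∀ᵐ y ∂μ, ∀ m : ℕ, ∀ S ∈ D, ∀ n : ℕ, y ∈ M m S n →
      ∀ δ : Y, ∃ (r : ℕ → ℝ) (d : ℕ → Y), Tendsto d atTop (𝓝 0) ∧
      (∀ k, y + d k ∈ M m S n) ∧ Tendsto (fun k => r k • d k) atTop (𝓝 δ) :=
    ae_all_iff.2 fun m => (ae_ball_iff hDc).2 fun S _ => ae_all_iff.2 fun n =>
      ae_mem_forall_exists_seq_tangent μ (hM m S n).measurableSet
  filter_upwards [hall] with y hy dc dg dfa dfy δ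
  set T := fderiv ℝ (fun a => f a y) (c y) with hT
  set v := fderiv ℝ c y δ with hv
  set R := fderiv ℝ (fun y => f (c y) y) y δ - fderiv ℝ (fun y' => f (c y) y') y δ with hR
  -- The argument yields the factor `3 / 2`; the `3` is slack.
  suffices hbound : ∀ m : ℕ, ‖R - T v‖ ≤ (3 * ‖v‖) * (1 / ((m : ℝ) + 1)) by
    have hlim := (tendsto_one_div_add_atTop_nhds_zero_nat (𝕜 := ℝ)).const_mul (3 * ‖v‖)
    rw [mul_zero] at hlim
    have h0 : ‖R - T v‖ ≤ 0 := ge_of_tendsto' hlim hbound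
    have h1 : R = T v := sub_eq_zero.1 (norm_le_zero_iff.1 h0)
    rw [← h1, hR]
    abel
  intro m
  set ε : ℝ := 1 / ((m : ℝ) + 1) with hε
  have hεpos : 0 < ε := by positivity
  obtain ⟨S, hSD, hS⟩ := hD.exists_dist_lt T (half_pos hεpos)
  rw [dist_eq_norm] at hS
  have hex : ∃ n : ℕ, y ∈ M m S n := by
    have h1 := dfa.hasFDerivAt.isLittleO
    rw [← hT, ← map_add_left_nhds_zero, Asymptotics.isLittleO_map] at h1
    obtain ⟨ρ, hρ, hρ'⟩ := Metric.eventually_nhds_iff.1 (h1.def (half_pos hεpos))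
    obtain ⟨n, hn⟩ := exists_nat_one_div_lt hρ
    refine ⟨n, fun u hu => ?_⟩
    have h2 := hρ' (y := u) (by simpa using hu.trans_lt hn)
    simp only [Function.comp_apply, add_sub_cancel_left] at h2
    calc ‖f (c y + u) y - f (c y) y - S u‖
        = ‖(f (c y + u) y - f (c y) y - T u) + (T - S) u‖ := by
          congr 1; simp
      _ ≤ ε / 2 * ‖u‖ + ε / 2 * ‖u‖ :=
          norm_add_le_of_le h2 ((T - S).le_of_opNorm_le hS.le u)
      _ = ε * ‖u‖ := by ring
  obtain ⟨n, hn⟩ := hex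
  obtain ⟨r, d, hd, hmem, hrd⟩ := hy m S hSD n hn δ
  have t1 := (hasFDerivWithinAt_univ.2 dg.hasFDerivAt).lim hd (.of_forall fun _ => trivial) hrd
  have t2 := (hasFDerivWithinAt_univ.2 dfy.hasFDerivAt).lim hd (.of_forall fun _ => trivial) hrd
  have t3 := (hasFDerivWithinAt_univ.2 dc.hasFDerivAt).lim hd (.of_forall fun _ => trivial) hrd
  have hdc : Tendsto (fun k => c y - c (y + d k)) atTop (𝓝 0) := by
    have : Tendsto (fun k => y + d k) atTop (𝓝 (y + 0)) := tendsto_const_nhds.add hd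
    rw [add_zero] at this
    simpa using (tendsto_const_nhds (x := c y)).sub ((hc.tendsto y).comp this)
  have hsmall : ∀ᶠ k in atTop, ‖c y - c (y + d k)‖ ≤ 1 / ((n : ℝ) + 1) := by
    have hp : (0 : ℝ) < 1 / ((n : ℝ) + 1) := by positivity
    refine (hdc.norm.eventually_lt_const (by rwa [norm_zero])).mono fun k hk => hk.le
  have hle : ∀ᶠ k in atTop,
      ‖(r k • (f (c (y + d k)) (y + d k) - f (c y) y) - r k • (f (c y) (y + d k) - f (c y) y))
        - S (r k • (c (y + d k) - c y))‖ ≤ ε * ‖r k • (c (y + d k) - c y)‖ := by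
    -- The approximation is applied at the base point `y + d k`, which also lies in `M m S n`, with
    -- `u = c y - c (y + d k)`. It thus compares the composite with the partial increment of `f (c
    -- y) ·`, and both have known derivatives at `y`.
    filter_upwards [hsmall] with k hk
    have h1 := hmem k _ hk
    rw [add_sub_cancel] at h1
    have h2 : (r k • (f (c (y + d k)) (y + d k) - f (c y) y)
        - r k • (f (c y) (y + d k) - f (c y) y)) - S (r k • (c (y + d k) - c y))
        = -(r k • (f (c y) (y + d k) - f (c (y + d k)) (y + d k) - S (c y - c (y + d k)))) := by
      simp only [map_smul, map_sub, smul_sub]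
      abel
    rw [h2, norm_neg, norm_smul, norm_smul, norm_sub_rev (c (y + d k))]
    calc _ ≤ ‖r k‖ * (ε * ‖c y - c (y + d k)‖) := by gcongr
      _ = _ := by ring
  have hlim := le_of_tendsto_of_tendsto
    (((t1.sub t2).sub ((S.continuous.tendsto _).comp t3)).norm) (t3.norm.const_mul ε) hle
  calc ‖R - T v‖ = ‖(R - S v) + (S - T) v‖ := by congr 1; simp
    _ ≤ ε * ‖v‖ + ε / 2 * ‖v‖ := norm_add_le_of_le hlim
        ((S - T).le_of_opNorm_le (by rw [norm_sub_rev]; exact hS.le) v)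
    _ ≤ 3 * ‖v‖ * ε := by nlinarith [norm_nonneg v, mul_nonneg (norm_nonneg v) hεpos.le]

/-- A Lipschitz map has a directional derivative along the tangent of any differentiable curve along
which it is differentiable. -/
theorem LipschitzWith.hasLineDerivAt_of_comp_graph {f : A → Y → W} {c : Y → A} {C : ℝ≥0}
    (hf : LipschitzWith C fun p : A × Y => f p.1 p.2) {y : Y} {c' : Y →L[ℝ] A} {g' : Y →L[ℝ] W}
    (hc : HasFDerivAt c c' y) (hg : HasFDerivAt (fun y => f (c y) y) g' y) (δ : Y) :
    HasLineDerivAt ℝ (fun p : A × Y => f p.1 p.2) (g' δ) (c y, y) (c' δ, δ) := by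
  have h1 : HasDerivAt (fun t : ℝ => f (c (y + t • δ)) (y + t • δ)) (g' δ) 0 :=
    hg.hasLineDerivAt δ
  have h2 : HasDerivAt (fun t : ℝ => c (y + t • δ)) (c' δ) 0 := hc.hasLineDerivAt δ
  -- The straight line and the curve through `(c y, y)` differ by `o(t)`, and so do the values of
  -- the Lipschitz map `f` on them.
  have h3 : (fun t : ℝ => f (c y + t • c' δ) (y + t • δ) - f (c (y + t • δ)) (y + t • δ))
      =o[𝓝 0] fun t : ℝ => t - 0 := by
    have h2' := h2.isLittleO
    refine (Asymptotics.IsBigO.of_bound C (.of_forall fun t => ?_)).trans_isLittleO h2'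
    have := hf.dist_le_mul (c y + t • c' δ, y + t • δ) (c (y + t • δ), y + t • δ)
    rw [dist_eq_norm, dist_comm, dist_eq_norm] at this
    refine this.trans_eq ?_
    simp [Prod.norm_def, sub_sub]
  have h4 : HasDerivAt
      (fun t : ℝ => f (c y + t • c' δ) (y + t • δ) - f (c (y + t • δ)) (y + t • δ)) 0 0 := by
    rw [hasDerivAt_iff_isLittleO]
    simpa using h3
  have h5 := h4.add h1
  rw [zero_add] at h5
  refine h5.congr_of_eventuallyEq (.of_forall fun t => ?_)
  simp

/-- A linear map whose kernel contains the kernel of `B` factors through `B`. -/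
theorem ContinuousLinearMap.exists_eq_comp_of_ker_le [FiniteDimensional ℝ A]
    (B : Y →L[ℝ] A) (N : Y →L[ℝ] W) (h : ∀ δ, B δ = 0 → N δ = 0) :
    ∃ T : A →L[ℝ] W, ∀ δ, T (B δ) = N δ := by
  let B' := B.toLinearMap
  let q : B'.range →ₗ[ℝ] W := (Submodule.liftQ (LinearMap.ker B') N.toLinearMap
    (fun δ hδ => h δ hδ)).comp B'.quotKerEquivRange.symm.toLinearMap
  obtain ⟨g, hg⟩ := q.exists_extend
  refine ⟨LinearMap.toContinuousLinearMap g, fun δ => ?_⟩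
  have h1 : g (B δ) = q ⟨B' δ, LinearMap.mem_range_self _ _⟩ := by rw [← hg]; rfl
  change g (B δ) = N δ
  rw [h1]
  simp only [q, LinearMap.comp_apply, LinearEquiv.coe_coe]
  rw [LinearMap.quotKerEquivRange_symm_apply_image]
  exact Submodule.liftQ_apply _ _ _

end ChainRule

/-! ### Choice of partial Jacobians -/

section PartialJacobians

variable {A Y W : Type*} [NormedAddCommGroup A] [NormedSpace ℝ A] [FiniteDimensional ℝ A]
  [NormedAddCommGroup Y] [NormedSpace ℝ Y] [FiniteDimensional ℝ Y]
  [NormedAddCommGroup W] [NormedSpace ℝ W] [FiniteDimensional ℝ W]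

/-- For a Lipschitz map `f` of two variables and countably many Lipschitz maps `c i`, the partial
Jacobians of `f` can be extended beyond the points of partial differentiability such that the chain
rule holds for all maps `y ↦ f (c i y) y` at almost every point. -/
theorem LipschitzWith.exists_partial_jacobians [MeasurableSpace Y] [BorelSpace Y]
    (μ : Measure Y) [μ.IsAddHaarMeasure] {ι : Type*} [Countable ι] {f : A → Y → W} {C : ℝ≥0}
    (hf : LipschitzWith C fun p : A × Y => f p.1 p.2) {c : ι → Y → A}
    (hc : ∀ i, ∃ K : ℝ≥0, LipschitzWith K (c i)) :
    ∃ (Ja : A → Y → A →L[ℝ] W) (Jy : A → Y → Y →L[ℝ] W),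
      (∀ a y, DifferentiableAt ℝ (fun a => f a y) a → Ja a y = fderiv ℝ (fun a => f a y) a) ∧
      (∀ a y, DifferentiableAt ℝ (fun y => f a y) y → Jy a y = fderiv ℝ (fun y => f a y) y) ∧
      ∀ᵐ y ∂μ, ∀ i c', HasFDerivAt (c i) c' y →
        HasFDerivAt (fun y => f (c i y) y) ((Ja (c i y) y).comp c' + Jy (c i y) y) y := by
  choose K hK using hc
  have hg : ∀ i, LipschitzWith (C * max (K i) 1) fun y => f (c i y) y := fun i =>
    hf.comp ((hK i).prodMk LipschitzWith.id)
  have hgood : ∀ᵐ y ∂μ, ∀ i,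
      DifferentiableAt ℝ (c i) y ∧ DifferentiableAt ℝ (fun y => f (c i y) y) y ∧
      (DifferentiableAt ℝ (fun a => f a y) (c i y) →
        DifferentiableAt ℝ (fun y' => f (c i y) y') y →
        ∀ δ, fderiv ℝ (fun y => f (c i y) y) y δ
          = fderiv ℝ (fun a => f a y) (c i y) (fderiv ℝ (c i) y δ)
            + fderiv ℝ (fun y' => f (c i y) y') y δ) ∧
      ∀ j, c i y = c j y → fderiv ℝ (c i) y = fderiv ℝ (c j) y ∧
        fderiv ℝ (fun y => f (c i y) y) y = fderiv ℝ (fun y => f (c j y) y) y := by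
    have h1 := ae_all_iff.2 fun i => (hK i).ae_differentiableAt (μ := μ)
    have h2 := ae_all_iff.2 fun i => (hg i).ae_differentiableAt (μ := μ)
    have h3 := ae_all_iff.2 fun i => ae_fderiv_comp_graph_eq μ hf.continuous (hK i).continuous
    have h4 := ae_all_iff.2 fun i => ae_all_iff.2 fun j =>
      ae_fderiv_eq_of_eq μ (hK i).continuous (hK j).continuous
    have h5 := ae_all_iff.2 fun i => ae_all_iff.2 fun j =>
      ae_fderiv_eq_of_eq μ (hg i).continuous (hg j).continuous
    filter_upwards [h1, h2, h3, h4, h5] with y h1 h2 h3 h4 h5 i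
    exact ⟨h1 i, h2 i, h3 i (h1 i) (h2 i), fun j hij =>
      ⟨h4 i j hij (h1 i) (h1 j), h5 i j (by rw [hij]) (h2 i) (h2 j)⟩⟩
  -- The a.e. properties enter as premises, so that a pair can be chosen at every `(a, y)`.
  have hex : ∀ a y, ∃ p : (A →L[ℝ] W) × (Y →L[ℝ] W),
      (DifferentiableAt ℝ (fun a => f a y) a → p.1 = fderiv ℝ (fun a => f a y) a) ∧
      (DifferentiableAt ℝ (fun y => f a y) y → p.2 = fderiv ℝ (fun y => f a y) y) ∧
      ∀ i, c i y = a → DifferentiableAt ℝ (c i) y →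
        DifferentiableAt ℝ (fun y => f (c i y) y) y →
        (DifferentiableAt ℝ (fun a => f a y) (c i y) →
          DifferentiableAt ℝ (fun y' => f (c i y) y') y →
          ∀ δ, fderiv ℝ (fun y => f (c i y) y) y δ
            = fderiv ℝ (fun a => f a y) (c i y) (fderiv ℝ (c i) y δ)
              + fderiv ℝ (fun y' => f (c i y) y') y δ) →
        (∀ j, c i y = c j y → fderiv ℝ (c i) y = fderiv ℝ (c j) y ∧
          fderiv ℝ (fun y => f (c i y) y) y = fderiv ℝ (fun y => f (c j y) y) y) →
        ∀ δ, fderiv ℝ (fun y => f (c i y) y) y δ = p.1 (fderiv ℝ (c i) y δ) + p.2 δ := by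
    intro a y
    by_cases hi : ∃ i, c i y = a ∧ DifferentiableAt ℝ (c i) y ∧
        DifferentiableAt ℝ (fun y => f (c i y) y) y
    · obtain ⟨i, rfl, dc, dg⟩ := hi
      set B := fderiv ℝ (c i) y with hB
      set N := fderiv ℝ (fun y => f (c i y) y) y with hN
      -- One curve `i` through the point suffices: any other one satisfying the coincidence premise
      -- has the same `B` and `N`.
      suffices ∃ p : (A →L[ℝ] W) × (Y →L[ℝ] W),
          (DifferentiableAt ℝ (fun a => f a y) (c i y) →
            p.1 = fderiv ℝ (fun a => f a y) (c i y)) ∧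
          (DifferentiableAt ℝ (fun y' => f (c i y) y') y →
            p.2 = fderiv ℝ (fun y' => f (c i y) y') y) ∧
          ((DifferentiableAt ℝ (fun a => f a y) (c i y) →
            DifferentiableAt ℝ (fun y' => f (c i y) y') y →
            ∀ δ, N δ = fderiv ℝ (fun a => f a y) (c i y) (B δ)
              + fderiv ℝ (fun y' => f (c i y) y') y δ) → ∀ δ, N δ = p.1 (B δ) + p.2 δ) by
        obtain ⟨p, hp1, hp2, hp3⟩ := this
        refine ⟨p, hp1, hp2, fun j hj _ _ hsum hcoin => ?_⟩
        obtain ⟨e1, e2⟩ := hcoin i hj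
        rw [hj, e1, e2] at hsum
        rw [e1, e2]
        exact hp3 hsum
      by_cases da : DifferentiableAt ℝ (fun a => f a y) (c i y)
      · by_cases dy : DifferentiableAt ℝ (fun y' => f (c i y) y') y
        · exact ⟨(_, _), fun _ => rfl, fun _ => rfl, fun h => h da dy⟩
        · exact ⟨(fderiv ℝ (fun a => f a y) (c i y), N - (fderiv ℝ (fun a => f a y) (c i y)).comp B),
            fun _ => rfl, fun h => absurd h dy, fun _ δ => by simp⟩
      · by_cases dy : DifferentiableAt ℝ (fun y' => f (c i y) y') y
        -- If `B δ = 0`, the directional derivative of `f` along `(B δ, δ) = (0, δ)` is both `N δ`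
        -- and the classical `y`-partial at `δ`. Hence the difference factors through `B`.
        · obtain ⟨T, hT⟩ := B.exists_eq_comp_of_ker_le
            (N - fderiv ℝ (fun y' => f (c i y) y') y) fun δ hδ => by
              have h1 := hf.hasLineDerivAt_of_comp_graph dc.hasFDerivAt dg.hasFDerivAt δ
              have h2 := dy.hasFDerivAt.hasLineDerivAt δ
              rw [← hB, ← hN, hδ] at h1
              have h3 : HasDerivAt (fun t : ℝ => f (c i y) (y + t • δ)) (N δ) 0 := by
                simpa [HasLineDerivAt] using h1
              simpa [sub_eq_zero] using h3.unique h2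
          exact ⟨(T, fderiv ℝ (fun y' => f (c i y) y') y), fun h => absurd h da, fun _ => rfl,
            fun _ δ => by simp [hT]⟩
        · exact ⟨(0, N), fun h => absurd h da, fun h => absurd h dy, fun _ δ => by simp⟩
    · exact ⟨(_, _), fun _ => rfl, fun _ => rfl,
        fun i h1 h2 h3 => absurd ⟨i, h1, h2, h3⟩ hi⟩
  choose p hp1 hp2 hp3 using hex
  refine ⟨fun a y => (p a y).1, fun a y => (p a y).2, hp1, hp2, ?_⟩
  filter_upwards [hgood] with y hy i c' hc'
  obtain ⟨dc, dg, hsum, hcoin⟩ := hy i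
  have := hp3 _ y i rfl dc dg hsum hcoin
  rw [hc'.fderiv] at this
  convert dg.hasFDerivAt using 1
  ext δ
  simp [this]

end PartialJacobians

/-! ### Existence and nonexpansiveness of proximal maps -/

section ProximalMap

open Filter Topology
open scoped RealInnerProductSpace

variable {X : Type*} [NormedAddCommGroup X] [InnerProductSpace ℝ X]

theorem EReal.coe_mul_le_coe_iff {c : ℝ} (hc : 0 < c) (a : EReal) (b : ℝ) :
    (c : EReal) * a ≤ b ↔ a ≤ ((c⁻¹ * b : ℝ) : EReal) := by
  induction a with
  | bot => simp [EReal.coe_mul_bot_of_pos hc]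
  | top =>
    rw [EReal.coe_mul_top_of_pos hc, top_le_iff, top_le_iff]
    exact iff_of_false (EReal.coe_ne_top _) (EReal.coe_ne_top _)
  | coe a =>
    rw [← EReal.coe_mul, EReal.coe_le_coe_iff, EReal.coe_le_coe_iff, ← div_eq_inv_mul,
      le_div_iff₀' hc]

theorem IsProperClosedConvex.coe_mul {G : X → EReal} (hG : IsProperClosedConvex G) {c : ℝ}
    (hc : 0 < c) : IsProperClosedConvex fun x => (c : EReal) * G x where
  ne_bot x := by
    have := hG.ne_bot x
    induction h : G x with
    | bot => exact absurd h this
    | top => simp [EReal.coe_mul_top_of_pos hc]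
    | coe a => rw [← EReal.coe_mul]; exact EReal.coe_ne_bot _
  exists_ne_top := by
    obtain ⟨x, hx⟩ := hG.exists_ne_top
    have := hG.ne_bot x
    refine ⟨x, ?_⟩
    induction h : G x with
    | bot => exact absurd h this
    | top => exact absurd h hx
    | coe a => rw [← EReal.coe_mul]; exact EReal.coe_ne_top _
  closed := by
    have hc0 : (c : EReal) ≠ 0 := by exact_mod_cast hc.ne'
    have hcont : Continuous fun a : EReal => (c : EReal) * a := continuous_iff_continuousAt.2
      fun a => (EReal.continuousAt_mul (p := ((c : EReal), a)) (.inl hc0) (.inl hc0)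
        (.inl (EReal.coe_ne_bot c)) (.inl (EReal.coe_ne_top c))).comp
          (continuousAt_const.prodMk continuousAt_id)
    exact hcont.comp_lowerSemicontinuous hG.closed fun a b hab =>
      mul_le_mul_of_nonneg_left hab (EReal.coe_nonneg.2 hc.le)
  convex := by
    intro p hp q hq a b ha hb hab
    simp only [Set.mem_ofPred_eq, EReal.coe_mul_le_coe_iff hc] at hp hq ⊢
    have := hG.convex (x := (p.1, c⁻¹ * p.2)) hp (y := (q.1, c⁻¹ * q.2)) hq ha hb hab
    simp only [Set.mem_ofPred_eq, Prod.fst_add, Prod.snd_add, Prod.smul_fst, Prod.smul_snd,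
      smul_eq_mul] at this ⊢
    convert this using 2
    ring

theorem IsProperClosedConvex.exists_coe_eq {G : X → EReal} (hG : IsProperClosedConvex G) {x : X}
    (hx : G x ≠ ⊤) : ∃ r : ℝ, G x = r :=
  ⟨(G x).toReal, (EReal.coe_toReal hx (hG.ne_bot x)).symm⟩

theorem IsProperClosedConvex.le_of_eq {G : X → EReal} (hG : IsProperClosedConvex G) {x z : X}
    {r s : ℝ} (hx : G x = r) (hz : G z = s) {t : ℝ} (ht0 : 0 ≤ t) (ht1 : t ≤ 1) :
    G (x + t • (z - x)) ≤ (((1 - t) * r + t * s : ℝ) : EReal) := by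
  have := hG.convex (x := (x, r)) hx.le (y := (z, s)) hz.le (sub_nonneg.2 ht1) ht0 (by ring)
  simp only [Set.mem_ofPred_eq, Prod.fst_add, Prod.snd_add, Prod.smul_fst, Prod.smul_snd,
      smul_eq_mul] at this
  convert this using 2
  module

/-- A proper closed convex function has a minorant which decays at most linearly. -/
theorem IsProperClosedConvex.exists_linear_minorant [FiniteDimensional ℝ X] {G : X → EReal}
    (hG : IsProperClosedConvex G) {x : X} {r : ℝ} (hx : G x = r) :
    ∃ m ≤ r, ∀ z (s : ℝ), G z = s → m - (r - m) * ‖z - x‖ ≤ s := by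
  -- `m` is the minimum of `G` on the closed unit ball around `x`. For `z` outside, convexity on the
  -- segment from `x` to `z`, at distance `1` from `x`, bounds `G z` from below.
  obtain ⟨w, hw, hmin⟩ := (hG.closed.lowerSemicontinuousOn _).exists_isMinOn
    ⟨x, Metric.mem_closedBall_self zero_le_one⟩ (isCompact_closedBall x 1)
  have hwx : G w ≤ r := hx ▸ hmin (Metric.mem_closedBall_self zero_le_one)
  obtain ⟨m, hm⟩ := hG.exists_coe_eq (ne_top_of_le_ne_top (EReal.coe_ne_top r) hwx)
  rw [hm, EReal.coe_le_coe_iff] at hwx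
  refine ⟨m, hwx, fun z s hs => ?_⟩
  rcases le_or_gt ‖z - x‖ 1 with h | h
  · have h1 : G w ≤ G z := hmin (by simpa [dist_eq_norm] using h)
    rw [hm, hs, EReal.coe_le_coe_iff] at h1
    nlinarith [norm_nonneg (z - x)]
  · have h0 : 0 < ‖z - x‖ := by linarith
    have h1 : G w ≤ G (x + ‖z - x‖⁻¹ • (z - x)) :=
      hmin (by simp [norm_smul, h0.ne'])
    have h2 := h1.trans (hG.le_of_eq hx hs (inv_nonneg.2 h0.le) (inv_le_one_of_one_le₀ h.le))
    rw [hm, EReal.coe_le_coe_iff] at h2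
    have h3 : m * ‖z - x‖ ≤ (‖z - x‖ - 1) * r + s := by
      calc m * ‖z - x‖ ≤ ((1 - ‖z - x‖⁻¹) * r + ‖z - x‖⁻¹ * s) * ‖z - x‖ := by gcongr
        _ = (‖z - x‖ - 1) * r + s := by field_simp
    linarith

/-- The proximal problem of a proper closed convex function has a solution. -/
theorem IsProperClosedConvex.exists_forall_prox_le [FiniteDimensional ℝ X] {G : X → EReal}
    (hG : IsProperClosedConvex G) (x : X) : ∃ p : X, ∀ z : X,
      ((1 / 2 * ‖p - x‖ ^ 2 : ℝ) : EReal) + G p ≤ ((1 / 2 * ‖z - x‖ ^ 2 : ℝ) : EReal) + G z := by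
  obtain ⟨x₀, hx₀⟩ := hG.exists_ne_top
  obtain ⟨r, hr⟩ := hG.exists_coe_eq hx₀
  obtain ⟨m, hmr, hm⟩ := hG.exists_linear_minorant hr
  have hlsc : LowerSemicontinuous fun z => ((1 / 2 * ‖z - x‖ ^ 2 : ℝ) : EReal) + G z := by
    refine LowerSemicontinuous.add' (Continuous.lowerSemicontinuous ?_) hG.closed fun z =>
      EReal.continuousAt_add (.inl (EReal.coe_ne_top _)) (.inl (EReal.coe_ne_bot _))
    exact continuous_coe_real_ereal.comp (by fun_prop)
  -- Beyond this radius the quadratic term beats the linear decay of `G`, and the objective is at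
  -- least its value at `x₀`. A minimizer on the compact ball is then global.
  set R := 2 * (‖x₀ - x‖ + (r - m)) + 2 with hR
  have hR0 : 0 ≤ R := by have := norm_nonneg (x₀ - x); linarith
  obtain ⟨p, hp, hmin⟩ := (hlsc.lowerSemicontinuousOn _).exists_isMinOn
    ⟨x₀, Metric.mem_closedBall_self hR0⟩ (isCompact_closedBall x₀ R)
  refine ⟨p, fun z => ?_⟩
  rcases le_or_gt ‖z - x₀‖ R with h | h
  · exact hmin (by simpa [dist_eq_norm] using h)
  refine (hmin (Metric.mem_closedBall_self hR0)).trans ?_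
  dsimp only
  by_cases hz : G z = ⊤
  · rw [hz, EReal.coe_add_top]; exact le_top
  obtain ⟨s, hs⟩ := hG.exists_coe_eq hz
  have h1 := hm z s hs
  rw [hr, hs, ← EReal.coe_add, ← EReal.coe_add, EReal.coe_le_coe_iff]
  have h2 : ‖z - x₀‖ - ‖x₀ - x‖ ≤ ‖z - x‖ := by
    have := norm_add_le (z - x) (x - x₀)
    rw [sub_add_sub_cancel, norm_sub_rev x x₀] at this
    linarith
  have he := norm_nonneg (x₀ - x)
  have h3 : (‖z - x₀‖ - ‖x₀ - x‖) ^ 2 ≤ ‖z - x‖ ^ 2 :=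
    pow_le_pow_left₀ (by linarith) h2 2
  nlinarith

theorem IsProperClosedConvex.prox_le [FiniteDimensional ℝ X] {G : X → EReal}
    (hG : IsProperClosedConvex G) (x z : X) :
    ((1 / 2 * ‖prox G x - x‖ ^ 2 : ℝ) : EReal) + G (prox G x)
      ≤ ((1 / 2 * ‖z - x‖ ^ 2 : ℝ) : EReal) + G z :=
  Classical.epsilon_spec (hG.exists_forall_prox_le x) z

theorem IsProperClosedConvex.exists_prox_eq_coe [FiniteDimensional ℝ X] {G : X → EReal}
    (hG : IsProperClosedConvex G) (x : X) : ∃ g : ℝ, G (prox G x) = g := by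
  obtain ⟨x₀, hx₀⟩ := hG.exists_ne_top
  obtain ⟨r, hr⟩ := hG.exists_coe_eq hx₀
  refine hG.exists_coe_eq fun htop => ?_
  have := hG.prox_le x x₀
  rw [htop, hr, EReal.coe_add_top, ← EReal.coe_add, top_le_iff] at this
  exact EReal.coe_ne_top _ this

/-- The variational inequality which characterizes the proximal map. -/
theorem IsProperClosedConvex.prox_variational [FiniteDimensional ℝ X] {G : X → EReal}
    (hG : IsProperClosedConvex G) (x z : X) {g s : ℝ} (hg : G (prox G x) = g) (hs : G z = s) :
    g ≤ s + ⟪prox G x - x, z - prox G x⟫ := by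
  set p := prox G x with hp
  -- Compare `p` with `p + t • (z - p)`, divide by `t`, and let `t` tend to `0`.
  have key : ∀ t ∈ Set.Ioc (0 : ℝ) 1,
      0 ≤ (s - g + ⟪p - x, z - p⟫) + t * (1 / 2 * ‖z - p‖ ^ 2) := by
    intro t ht
    have h1 := (hG.prox_le x (p + t • (z - p))).trans
      (add_le_add_right (hG.le_of_eq hg hs ht.1.le ht.2) _)
    rw [← hp, hg, ← EReal.coe_add, ← EReal.coe_add, EReal.coe_le_coe_iff,
      add_sub_right_comm, norm_add_sq_real, inner_smul_right, norm_smul, mul_pow,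
      Real.norm_of_nonneg ht.1.le] at h1
    refine nonneg_of_mul_nonneg_right (?_ : 0 ≤ t * _) ht.1
    nlinarith
  have hlim : Tendsto (fun t : ℝ => (s - g + ⟪p - x, z - p⟫) + t * (1 / 2 * ‖z - p‖ ^ 2))
      (𝓝[>] 0) (𝓝 ((s - g + ⟪p - x, z - p⟫) + 0 * (1 / 2 * ‖z - p‖ ^ 2))) :=
    (Continuous.tendsto (by fun_prop) 0).mono_left nhdsWithin_le_nhds
  have := ge_of_tendsto hlim (by
    filter_upwards [Ioc_mem_nhdsGT (zero_lt_one' ℝ)] with t ht using key t ht)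
  linarith

/-- Proximal maps are nonexpansive. -/
theorem IsProperClosedConvex.lipschitzWith_prox [FiniteDimensional ℝ X] {G : X → EReal}
    (hG : IsProperClosedConvex G) : LipschitzWith 1 (prox G) := by
  refine LipschitzWith.of_dist_le_mul fun x x' => ?_
  obtain ⟨g, hg⟩ := hG.exists_prox_eq_coe x
  obtain ⟨g', hg'⟩ := hG.exists_prox_eq_coe x'
  have h1 := hG.prox_variational x _ hg hg'
  have h2 := hG.prox_variational x' _ hg' hg
  -- Firm nonexpansiveness: the sum of the two variational inequalities, in which the values of `G`
  -- cancel.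
  have h3 : ⟪prox G x - prox G x', prox G x - prox G x'⟫
      ≤ ⟪x - x', prox G x - prox G x'⟫ := by
    have e : ⟪prox G x - x, prox G x' - prox G x⟫ + ⟪prox G x' - x', prox G x - prox G x'⟫
        = ⟪x - x', prox G x - prox G x'⟫ - ⟪prox G x - prox G x', prox G x - prox G x'⟫ := by
      rw [← neg_sub (prox G x) (prox G x'), inner_neg_right, ← inner_sub_left, ← inner_neg_left,
        ← inner_add_left]
      congr 1
      abel
    linarith
  rw [real_inner_self_eq_norm_sq] at h3
  have h4 := h3.trans (real_inner_le_norm _ _)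
  rw [dist_eq_norm, dist_eq_norm, NNReal.coe_one, one_mul]
  rcases (norm_nonneg (prox G x - prox G x')).eq_or_lt with h | h
  · rw [← h]; exact norm_nonneg _
  · nlinarith

end ProximalMap

/-! ### Lipschitz regularity of the iteration -/

section GFBRegularity

variable {X Y Θ : Type*} [NormedAddCommGroup X] [InnerProductSpace ℝ X] [FiniteDimensional ℝ X]
  {Q : ℕ} {ν : ℝ} {L : ℝ≥0}
  {F : X → Y → Θ → ℝ} {G : Fin Q → X → Y → Θ → EReal} {a₀ : Y → Θ → X × (Fin Q → X)} {θ : Θ}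

theorem lipschitzWith_gfbProx (hQ : 0 < Q) (hν : 0 < ν)
    (hG : ∀ k y, IsProperClosedConvex (fun x => G k x y θ)) (k : Fin Q) (y : Y) :
    LipschitzWith 1 fun x => gfbProx ν G k x y θ :=
  ((hG k y).coe_mul (c := ν * Q) (by positivity)).lipschitzWith_prox

variable [NormedAddCommGroup Y]

/-- Separate Lipschitz bounds give a joint one because each constant is uniform in the other
variable. -/
theorem exists_lipschitzWith_gfbProx (hQ : 0 < Q) (hν : 0 < ν)
    (hG : ∀ k y, IsProperClosedConvex (fun x => G k x y θ)) (k : Fin Q)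
    (hG_lip_y : ∃ C : ℝ≥0, ∀ x, LipschitzWith C (fun y => gfbProx ν G k x y θ)) :
    ∃ C : ℝ≥0, LipschitzWith C fun p : X × Y => gfbProx ν G k p.1 p.2 θ := by
  obtain ⟨C, hC⟩ := hG_lip_y
  exact ⟨_, LipschitzWith.uncurry (f := fun x y => gfbProx ν G k x y θ)
    (lipschitzWith_gfbProx hQ hν hG k) hC⟩

theorem exists_lipschitzWith_gradFst
    (hF_lip : ∀ y, LipschitzWith L (fun x => gradFst F x y θ))
    (hF_lip_y : ∃ C : ℝ≥0, ∀ x, LipschitzWith C (fun y => gradFst F x y θ)) :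
    ∃ C : ℝ≥0, LipschitzWith C fun p : X × Y => gradFst F p.1 p.2 θ := by
  obtain ⟨C, hC⟩ := hF_lip_y
  exact ⟨_, LipschitzWith.uncurry (f := fun x y => gradFst F x y θ) hF_lip hC⟩

omit [InnerProductSpace ℝ X] [FiniteDimensional ℝ X] in
theorem lipschitzWith_fst_fst :
    LipschitzWith 1 fun p : (X × (Fin Q → X)) × Y => p.1.1 := by
  have := (LipschitzWith.prod_fst (α := X) (β := Fin Q → X)).comp
    (LipschitzWith.prod_fst (α := X × (Fin Q → X)) (β := Y))
  rwa [one_mul] at this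

omit [InnerProductSpace ℝ X] [FiniteDimensional ℝ X] in
theorem lipschitzWith_fst_snd_apply (k : Fin Q) :
    LipschitzWith 1 fun p : (X × (Fin Q → X)) × Y => p.1.2 k := by
  have := (LipschitzWith.eval (α := fun _ : Fin Q => X) k).comp
    ((LipschitzWith.prod_snd (α := X) (β := Fin Q → X)).comp
      (LipschitzWith.prod_fst (α := X × (Fin Q → X)) (β := Y)))
  rwa [one_mul, one_mul] at this

theorem exists_lipschitzWith_gfbZ
    (hF : ∃ C : ℝ≥0, LipschitzWith C fun p : X × Y => gradFst F p.1 p.2 θ) (k : Fin Q) :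
    ∃ C : ℝ≥0, LipschitzWith C fun p : (X × (Fin Q → X)) × Y => gfbZ ν F k p.1 p.2 θ := by
  obtain ⟨C, hC⟩ := hF
  have h := hC.comp ((lipschitzWith_fst_fst (X := X) (Y := Y) (Q := Q)).prodMk
    LipschitzWith.prod_snd)
  exact ⟨_, (((lipschitzWith_smul (2 : ℝ)).comp lipschitzWith_fst_fst).sub
    (lipschitzWith_fst_snd_apply k)).sub ((lipschitzWith_smul ν).comp h)⟩

theorem exists_lipschitzWith_gfbNewz
    (hF : ∃ C : ℝ≥0, LipschitzWith C fun p : X × Y => gradFst F p.1 p.2 θ) (k : Fin Q)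
    (hG : ∃ C : ℝ≥0, LipschitzWith C fun p : X × Y => gfbProx ν G k p.1 p.2 θ) :
    ∃ C : ℝ≥0, LipschitzWith C fun p : (X × (Fin Q → X)) × Y => gfbNewz ν F G p.1 p.2 θ k := by
  obtain ⟨C, hC⟩ := hG
  obtain ⟨D, hD⟩ := exists_lipschitzWith_gfbZ (ν := ν) hF k
  have h := hC.comp (hD.prodMk (LipschitzWith.prod_snd (α := X × (Fin Q → X)) (β := Y)))
  exact ⟨_, ((lipschitzWith_fst_snd_apply k).sub lipschitzWith_fst_fst).add h⟩

theorem exists_lipschitzWith_gfbPsi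
    (hF : ∃ C : ℝ≥0, LipschitzWith C fun p : X × Y => gradFst F p.1 p.2 θ)
    (hG : ∀ k, ∃ C : ℝ≥0, LipschitzWith C fun p : X × Y => gfbProx ν G k p.1 p.2 θ) :
    ∃ C : ℝ≥0, LipschitzWith C fun p : (X × (Fin Q → X)) × Y => gfbPsi ν F G p.1 p.2 θ := by
  choose C hC using fun k => exists_lipschitzWith_gfbNewz hF k (hG k)
  have hpi : LipschitzWith (∑ k, C k)
      fun p : (X × (Fin Q → X)) × Y => gfbNewz ν F G p.1 p.2 θ := by
    refine LipschitzWith.of_dist_le_mul fun p q => (dist_pi_le_iff (by positivity)).2 fun k => ?_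
    refine ((hC k).dist_le_mul p q).trans ?_
    gcongr
    exact Finset.single_le_sum (f := C) (fun _ _ => zero_le) (Finset.mem_univ k)
  let S : (Fin Q → X) →L[ℝ] X :=
    (1 / (Q : ℝ)) • ∑ k, ContinuousLinearMap.proj (R := ℝ) (φ := fun _ : Fin Q => X) k
  have hS := (S.lipschitz.comp hpi).prodMk hpi
  refine ⟨max (‖S‖₊ * ∑ k, C k) (∑ k, C k), ?_⟩
  convert hS using 2 with p
  simp [S, gfbPsi]

/-- Composition of Lipschitz maps; the constant may grow with `ℓ`, which is harmless as each iterate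
is treated separately. -/
theorem exists_lipschitzWith_gfbA
    (hF : ∃ C : ℝ≥0, LipschitzWith C fun p : X × Y => gradFst F p.1 p.2 θ)
    (hG : ∀ k, ∃ C : ℝ≥0, LipschitzWith C fun p : X × Y => gfbProx ν G k p.1 p.2 θ)
    (ha₀ : ∃ C : ℝ≥0, LipschitzWith C (fun y => a₀ y θ)) (ℓ : ℕ) :
    ∃ C : ℝ≥0, LipschitzWith C fun y => gfbA ν F G a₀ ℓ y θ := by
  induction ℓ with
  | zero => exact ha₀
  | succ ℓ ih =>
    obtain ⟨C, hC⟩ := ih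
    obtain ⟨D, hD⟩ := exists_lipschitzWith_gfbPsi hF hG
    have h := hD.comp (hC.prodMk LipschitzWith.id)
    exact ⟨_, h⟩

end GFBRegularity

/-! ### Differentiation of the iterates -/

theorem mainTheorem8
    {X Y Θ : Type*}
    [NormedAddCommGroup X] [InnerProductSpace ℝ X] [FiniteDimensional ℝ X]
    [MeasurableSpace X] [BorelSpace X]
    [NormedAddCommGroup Y] [InnerProductSpace ℝ Y] [FiniteDimensional ℝ Y]
    [MeasurableSpace Y] [BorelSpace Y]
    {Q : ℕ} (hQ : 0 < Q) (ν : ℝ) (hν : 0 < ν) (L : ℝ≥0)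
    (F : X → Y → Θ → ℝ) (G : Fin Q → X → Y → Θ → EReal)
    (a₀ : Y → Θ → X × (Fin Q → X)) (θ : Θ)
    -- the structural assumptions of the splitting
    (hF_conv : ∀ y, ConvexOn ℝ Set.univ (fun x => F x y θ))
    (hF_diff : ∀ y, ContDiff ℝ 1 (fun x => F x y θ))
    (hF_lip : ∀ y, LipschitzWith L (fun x => gradFst F x y θ))
    (hG : ∀ k y, IsProperClosedConvex (fun x => G k x y θ))
    -- the Lipschitz assumptions with respect to `y`
    (hF_lip_y : ∃ C : ℝ≥0, ∀ x, LipschitzWith C (fun y => gradFst F x y θ))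
    (hG_lip_y : ∀ k, ∃ C : ℝ≥0, ∀ x, LipschitzWith C (fun y => gfbProx ν G k x y θ))
    (ha₀ : ∃ C : ℝ≥0, LipschitzWith C (fun y => a₀ y θ)) :
    -- all iterates are weakly differentiable in `y`
    (∀ ℓ, WeaklyDifferentiable (fun y => gfbA ν F G a₀ ℓ y θ)) ∧
    (∀ ℓ, WeaklyDifferentiable (fun y => gfbX ν F G a₀ ℓ y θ)) ∧
    (∀ ℓ k, WeaklyDifferentiable (fun y => gfbz ν F G a₀ ℓ k y θ)) ∧
    (∀ ℓ k, WeaklyDifferentiable (fun y => gfbZIter ν F G a₀ ℓ k y θ)) ∧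
    -- versions of the weak Jacobians of `γ`, `ψ`, of the proximal maps and of `∇₁F`
    ∃ (Γ : X × (Fin Q → X) → (X × (Fin Q → X)) →L[ℝ] X)
      (Ψa : X × (Fin Q → X) → Y → (X × (Fin Q → X)) →L[ℝ] (X × (Fin Q → X)))
      (Ψy : X × (Fin Q → X) → Y → Y →L[ℝ] (X × (Fin Q → X)))
      (Gx : Fin Q → X → Y → X →L[ℝ] X) (Gy : Fin Q → X → Y → Y →L[ℝ] X)
      (Fx : X → Y → X →L[ℝ] X) (Fy : X → Y → Y →L[ℝ] X),
      IsPointwiseWeakJacobian (fun a : X × (Fin Q → X) => gfbGamma a) Γ ∧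
      (∀ y, IsPointwiseWeakJacobian (fun a => gfbPsi ν F G a y θ) (fun a => Ψa a y)) ∧
      (∀ a, IsPointwiseWeakJacobian (fun y => gfbPsi ν F G a y θ) (fun y => Ψy a y)) ∧
      (∀ k y, IsPointwiseWeakJacobian (fun x => gfbProx ν G k x y θ) (fun x => Gx k x y)) ∧
      (∀ k x, IsPointwiseWeakJacobian (fun y => gfbProx ν G k x y θ) (fun y => Gy k x y)) ∧
      (∀ y, IsPointwiseWeakJacobian (fun x => gradFst F x y θ) (fun x => Fx x y)) ∧
      (∀ x, IsPointwiseWeakJacobian (fun y => gradFst F x y θ) (fun y => Fy x y)) ∧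
      -- whatever versions of the weak Jacobians of the iterates are taken
      ∀ (Da : ℕ → Y → Y →L[ℝ] (X × (Fin Q → X))) (Dx : ℕ → Y → Y →L[ℝ] X)
        (Dz DZ : ℕ → Fin Q → Y → Y →L[ℝ] X),
        (∀ ℓ, IsWeakJacobian (fun y => gfbA ν F G a₀ ℓ y θ) (Da ℓ)) →
        (∀ ℓ, IsWeakJacobian (fun y => gfbX ν F G a₀ ℓ y θ) (Dx ℓ)) →
        (∀ ℓ k, IsWeakJacobian (fun y => gfbz ν F G a₀ ℓ k y θ) (Dz ℓ k)) →
        (∀ ℓ k, IsWeakJacobian (fun y => gfbZIter ν F G a₀ ℓ k y θ) (DZ ℓ k)) →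
        ∀ᵐ y ∂(volume : Measure Y), ∀ (δ : Y) (ℓ : ℕ),
          Da ℓ y δ = (Dx ℓ y δ, fun k => Dz ℓ k y δ) ∧
          Dx ℓ y δ = Γ (gfbA ν F G a₀ ℓ y θ) (Da ℓ y δ) ∧
          Da (ℓ + 1) y δ
            = Ψa (gfbA ν F G a₀ ℓ y θ) y (Da ℓ y δ) + Ψy (gfbA ν F G a₀ ℓ y θ) y δ ∧
          Dx (ℓ + 1) y δ = (1 / (Q : ℝ)) • ∑ k, Dz (ℓ + 1) k y δ ∧
          (∀ k, Dz (ℓ + 1) k y δ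
            = Dz ℓ k y δ - Dx ℓ y δ
              + Gx k (gfbZIter ν F G a₀ ℓ k y θ) y (DZ ℓ k y δ)
              + Gy k (gfbZIter ν F G a₀ ℓ k y θ) y δ) ∧
          (∀ k, DZ ℓ k y δ
            = (2 : ℝ) • Dx ℓ y δ - Dz ℓ k y δ
              - ν • (Fx (gfbX ν F G a₀ ℓ y θ) y (Dx ℓ y δ)
                + Fy (gfbX ν F G a₀ ℓ y θ) y δ)) ∧
          -- the derivative terms are the directional derivatives of `ψ`, `Prox`, `∇₁F`
          HasLineDerivAt ℝ
            (fun p : (X × (Fin Q → X)) × Y => gfbPsi ν F G p.1 p.2 θ)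
            (Ψa (gfbA ν F G a₀ ℓ y θ) y (Da ℓ y δ) + Ψy (gfbA ν F G a₀ ℓ y θ) y δ)
            (gfbA ν F G a₀ ℓ y θ, y) (Da ℓ y δ, δ) ∧
          (∀ k, HasLineDerivAt ℝ (fun p : X × Y => gfbProx ν G k p.1 p.2 θ)
            (Gx k (gfbZIter ν F G a₀ ℓ k y θ) y (DZ ℓ k y δ)
              + Gy k (gfbZIter ν F G a₀ ℓ k y θ) y δ)
            (gfbZIter ν F G a₀ ℓ k y θ, y) (DZ ℓ k y δ, δ)) ∧
          HasLineDerivAt ℝ (fun p : X × Y => gradFst F p.1 p.2 θ)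
            (Fx (gfbX ν F G a₀ ℓ y θ) y (Dx ℓ y δ) + Fy (gfbX ν F G a₀ ℓ y θ) y δ)
            (gfbX ν F G a₀ ℓ y θ, y) (Dx ℓ y δ, δ) := by
  have hGl : ∀ k, ∃ C : ℝ≥0, LipschitzWith C fun p : X × Y => gfbProx ν G k p.1 p.2 θ :=
    fun k => exists_lipschitzWith_gfbProx hQ hν hG k (hG_lip_y k)
  have hFl := exists_lipschitzWith_gradFst hF_lip hF_lip_y
  have hΨl := exists_lipschitzWith_gfbPsi (ν := ν) hFl hGl
  have hAl := exists_lipschitzWith_gfbA hFl hGl ha₀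
  have hXl : ∀ ℓ, ∃ C : ℝ≥0, LipschitzWith C fun y => gfbX ν F G a₀ ℓ y θ := fun ℓ =>
    (hAl ℓ).elim fun _ h => ⟨_, LipschitzWith.prod_fst.comp h⟩
  have hzl : ∀ ℓ k, ∃ C : ℝ≥0, LipschitzWith C fun y => gfbz ν F G a₀ ℓ k y θ := fun ℓ k =>
    (hAl ℓ).elim fun _ h => ⟨_, (LipschitzWith.eval (α := fun _ : Fin Q => X) k).comp
      (LipschitzWith.prod_snd.comp h)⟩
  have hZl : ∀ ℓ k, ∃ C : ℝ≥0, LipschitzWith C fun y => gfbZIter ν F G a₀ ℓ k y θ := fun ℓ k =>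
    (hAl ℓ).elim fun _ h => (exists_lipschitzWith_gfbZ (ν := ν) hFl k).elim fun _ h' =>
      ⟨_, h'.comp (h.prodMk LipschitzWith.id)⟩
  have : (volume : Measure (X × (Fin Q → X))).IsAddHaarMeasure := by
    have : (volume : Measure (Fin Q → X)).IsAddHaarMeasure := by
      rw [volume_pi]
      infer_instance
    rw [Measure.volume_eq_prod]
    infer_instance
  refine ⟨fun ℓ => (hAl ℓ).elim fun _ h => h.weaklyDifferentiable,
    fun ℓ => (hXl ℓ).elim fun _ h => h.weaklyDifferentiable,
    fun ℓ k => (hzl ℓ k).elim fun _ h => h.weaklyDifferentiable,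
    fun ℓ k => (hZl ℓ k).elim fun _ h => h.weaklyDifferentiable, ?_⟩
  obtain ⟨CΨ, hCΨ⟩ := hΨl
  obtain ⟨CF, hCF⟩ := hFl
  choose CG hCG using hGl
  -- The countable family of curves is indexed by `ℓ`: `a^(ℓ)` for `ψ`, `x^(ℓ)` for `∇₁F`, and
  -- `Z_k^(ℓ)` for each proximal map. The choices precede, and do not depend on, the versions `Da`,
  -- `Dx`, `Dz`, `DZ`.
  obtain ⟨Ψa, Ψy, hΨa, hΨy, hΨ⟩ := LipschitzWith.exists_partial_jacobians (volume : Measure Y)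
    (f := fun a y => gfbPsi ν F G a y θ) hCΨ hAl
  obtain ⟨Fx, Fy, hFx, hFy, hFc⟩ := LipschitzWith.exists_partial_jacobians (volume : Measure Y)
    (f := fun x y => gradFst F x y θ) hCF hXl
  choose Gx Gy hGx hGy hGc using fun k => LipschitzWith.exists_partial_jacobians
    (volume : Measure Y) (f := fun x y => gfbProx ν G k x y θ) (hCG k) (fun ℓ => hZl ℓ k)
  refine ⟨fun _ => ContinuousLinearMap.fst ℝ X (Fin Q → X), Ψa, Ψy, Gx, Gy, Fx, Fy,
    LipschitzWith.prod_fst.isPointwiseWeakJacobian fun a _ => (hasFDerivAt_fst).fderiv.symm,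
    fun y => (hCΨ.comp (LipschitzWith.prodMk_right y)).isPointwiseWeakJacobian fun a => hΨa a y,
    fun a => (hCΨ.comp (LipschitzWith.prodMk_left a)).isPointwiseWeakJacobian fun y => hΨy a y,
    fun k y => ((hCG k).comp (LipschitzWith.prodMk_right y)).isPointwiseWeakJacobian
      fun x => hGx k x y,
    fun k x => ((hCG k).comp (LipschitzWith.prodMk_left x)).isPointwiseWeakJacobian
      fun y => hGy k x y,
    fun y => (hCF.comp (LipschitzWith.prodMk_right y)).isPointwiseWeakJacobian fun x => hFx x y,
    fun x => (hCF.comp (LipschitzWith.prodMk_left x)).isPointwiseWeakJacobian fun y => hFy x y,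
    ?_⟩
  intro Da Dx Dz DZ hDa hDx hDz hDZ
  have eA := ae_all_iff.2 fun ℓ => (hAl ℓ).elim fun _ h => (hDa ℓ).ae_hasFDerivAt h
  have eX := ae_all_iff.2 fun ℓ => (hXl ℓ).elim fun _ h => (hDx ℓ).ae_hasFDerivAt h
  have ez := ae_all_iff.2 fun ℓ => ae_all_iff.2 fun k =>
    (hzl ℓ k).elim fun _ h => (hDz ℓ k).ae_hasFDerivAt h
  have eZ := ae_all_iff.2 fun ℓ => ae_all_iff.2 fun k =>
    (hZl ℓ k).elim fun _ h => (hDZ ℓ k).ae_hasFDerivAt h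
  filter_upwards [eA, eX, ez, eZ, hΨ, hFc, ae_all_iff.2 hGc] with y eA eX ez eZ hΨ hFc hGc δ ℓ
  have dΨ := hΨ ℓ _ (eA ℓ)
  have dF := hFc ℓ _ (eX ℓ)
  have dG := fun k => hGc k ℓ _ (eZ ℓ k)
  -- Each recursion equates two Fréchet derivatives at `y` of one function, written in two
  -- definitionally equal ways.
  have uX : ∀ ℓ, Dx ℓ y = (ContinuousLinearMap.fst ℝ X (Fin Q → X)).comp (Da ℓ y) := fun ℓ =>
    (eX ℓ).unique (hasFDerivAt_fst.comp y (eA ℓ))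
  have uz : ∀ ℓ k, Dz ℓ k y = (ContinuousLinearMap.proj k).comp
      ((ContinuousLinearMap.snd ℝ X (Fin Q → X)).comp (Da ℓ y)) := fun ℓ k =>
    (ez ℓ k).unique (((ContinuousLinearMap.proj k).comp
      (ContinuousLinearMap.snd ℝ X (Fin Q → X))).hasFDerivAt.comp y (eA ℓ))
  have uA := (eA (ℓ + 1)).unique dΨ
  have uX' := (eX (ℓ + 1)).unique
    ((HasFDerivAt.fun_sum fun k _ => ez (ℓ + 1) k).const_smul (1 / (Q : ℝ)))
  have uz' := fun k => (ez (ℓ + 1) k).unique (((ez ℓ k).sub (eX ℓ)).add (dG k))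
  have uZ := fun k => (eZ ℓ k).unique ((((eX ℓ).const_smul (2 : ℝ)).sub (ez ℓ k)).sub
    (dF.const_smul ν))
  refine ⟨?_, ?_, ?_, ?_, fun k => ?_, fun k => ?_, ?_, fun k => ?_, ?_⟩
  · ext <;> simp [uX, uz]
  · simp [uX]
  · simp [uA]
  · simp [uX']
  · simp [uz' k, add_assoc]
  · simp [uZ k]
  · exact hCΨ.hasLineDerivAt_of_comp_graph (f := fun a y => gfbPsi ν F G a y θ) (eA ℓ) dΨ δ
  · exact (hCG k).hasLineDerivAt_of_comp_graph (f := fun x y => gfbProx ν G k x y θ)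
      (eZ ℓ k) (dG k) δ
  · exact hCF.hasLineDerivAt_of_comp_graph (f := fun x y => gradFst F x y θ) (eX ℓ) dF δ
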